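/- Let $d\in\mathbb{N}_0$, $\hbar>0$, let $S=\begin{bmatrix}A&B\\C&D\end{bmatrix}\in\mathsf{Sp}(2d,\mathbb{R})$ and $z=(q,p)\in\mathbb{R}^d\times\mathbb{R}^d$, and put $Q=A+\mathrm{i}B$, $P=C+\mathrm{i}D$ and $|Q|=(QQ^*)^{1/2}$. With $\hat x_j f(x)=x_jf(x)$ and $\hat p_jf=-\mathrm{i}\hbar\,\partial f/\partial x_j$, let $$\mathscr{A}^*(S,z)=\frac{\mathrm{i}}{\sqrt{2\hbar}}\bigl[P^*(\hat x-q)-Q^*(\hat p-p)\bigr]$$ be the Hagedorn raising operators. Let $$\varphi^\hbar_0(S,z;x)=\frac{(\det Q)^{-1/2}}{(\pi\hbar)^{d/4}}\exp\Bigl\{\frac{\mathrm{i}}{\hbar}\Bigl[\tfrac12(x-q)^TPQ^{-1}(x-q)+p\cdot(x-q)\Bigr]\Bigr\}$$ with either choice of the square root, and let the wave packets $\varphi^\hbar_n$, $n\in\mathbb{N}_0^d$, be generated by $\varphi^\hbar_{n+e_j}=(n_j+1)^{-1/2}\mathscr{A}^*_j(S,z)\varphi^\hbar_n$. The Hagedorn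 polynomials are $$\mathcal{P}^\hbar_n(S,z;x)=\sqrt{2^{|n|}n!}\;\frac{\varphi^\hbar_n(S,z;x)}{\varphi^\hbar_0(S,z;x)},\qquad |n|=n_1+\dots+n_d,\quad n!=n_1!\cdots n_d!.$$ Let $p^\hbar_k(y)=\prod_{j=1}^d H_{k_j}(y_j/\sqrt\hbar)$ be the scaled Hermite polynomials, where $H_0=1$ and $H_{m+1}(t)=2tH_m(t)-H_m'(t)$. Let $f^k_n(Q)$ be the coefficient of $w^n=w_1^{n_1}\cdots w_d^{n_d}$ in the polynomial $(|Q|^{-1}\overline{Q}w)^k$ in $w=(w_1,\dots,w_d)$. Then $f^k_n(Q)=0$ whenever $|k|\ne|n|$; for all $k\in\mathbb{N}_0^d$ and $w\in\mathbb{C}^d$, $$(|Q|^{-1}\overline{Q}w)^k=\sum_{n\in\mathbb{N}_0^d,\ |n|=|k|}f^k_n(Q)\,w^n;$$ and for all $n\in\mathbb{N}_0^d$ and $x\in\mathbb{R}^d$, the Hagedorn polynomial is the following finite combination of scaled Hermite polynomials of total degree $|n|$: $$\mathcal{P}^\hbar_n(S,z;x)=\sum_{k\in\mathbb{N}_0^d,\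 |k|=|n|}\frac{n!}{k!}\,f^k_n(Q)\,p^\hbar_k\bigl(|Q|^{-1}(x-q)\bigr).$$ -/

import Mathlib

open scoped MatrixOrder ComplexOrder

noncomputable section

namespace Hagedorn

/-! Multi-indices are elements of `Fin d →₀ ℕ`; `n.degree` is the total degree `|n|`. -/

/-- The multi-index factorial `n! = n₁! ⋯ n_d!`. -/
def multiFactorial {d : ℕ} (n : Fin d →₀ ℕ) : ℕ := ∏ j, (n j).factorial

/-- The constant `c_n = √(2^|n| n!)`. -/
def normConst {d : ℕ} (n : Fin d →₀ ℕ) : ℝ := Real.sqrt (2 ^ n.degree * multiFactorial n)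

/-! ### Hermite polynomials -/

/-- The (physicists') Hermite polynomials `1, 2X, 4X² - 2, …`. -/
def hermitePoly : ℕ → Polynomial ℤ
  | 0 => 1
  | n + 1 => 2 * Polynomial.X * hermitePoly n - Polynomial.derivative (hermitePoly n)

/-- The semiclassically scaled Hermite polynomial
`p_k^ħ(y) = ∏_j H_{k_j}(y_j / √ħ)`, as a polynomial function on `ℂ^d`. -/
def scaledHermite {d : ℕ} (ħ : ℝ) (k : Fin d →₀ ℕ) (y : Fin d → ℂ) : ℂ :=
  ∏ j, Polynomial.aeval (y j / (Real.sqrt ħ : ℂ)) (hermitePoly (k j))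

/-! ### The complex matrices attached to a symplectic matrix -/

/-- `Q = A + i B` for `S = [A B; C D]`, so that `A = Re Q` and `B = Im Q`. -/
def matQ {d : ℕ} (S : Matrix (Fin d ⊕ Fin d) (Fin d ⊕ Fin d) ℝ) : Matrix (Fin d) (Fin d) ℂ :=
  Matrix.of fun i j => (S (Sum.inl i) (Sum.inl j) : ℂ) + Complex.I * S (Sum.inl i) (Sum.inr j)

/-- `P = C + i D` for `S = [A B; C D]`, so that `C = Re P` and `D = Im P`. -/
def matP {d : ℕ} (S : Matrix (Fin d ⊕ Fin d) (Fin d ⊕ Fin d) ℝ) : Matrix (Fin d) (Fin d) ℂ :=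
  Matrix.of fun i j => (S (Sum.inr i) (Sum.inl j) : ℂ) + Complex.I * S (Sum.inr i) (Sum.inr j)

/-- `|Q| = (Q Q^*)^{1/2}`, the positive semidefinite square root. -/
def absMat {d : ℕ} (Q : Matrix (Fin d) (Fin d) ℂ) : Matrix (Fin d) (Fin d) ℂ :=
  CFC.sqrt (Q * Q.conjTranspose)

/-- The polynomial `(|Q|⁻¹ Q̄ w)^k` in the variables `w = (w_1, …, w_d)`. -/
def transitionPoly {d : ℕ} (Q : Matrix (Fin d) (Fin d) ℂ) (k : Fin d →₀ ℕ) :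
    MvPolynomial (Fin d) ℂ :=
  ∏ i, (∑ j, MvPolynomial.C (((absMat Q)⁻¹ * Q.map (starRingEnd ℂ)) i j) * MvPolynomial.X j) ^ k i

/-- The coefficient `f^k_n(Q)` of `w^n` in `(|Q|⁻¹ Q̄ w)^k`. -/
def transitionCoeff {d : ℕ} (Q : Matrix (Fin d) (Fin d) ℂ) (k n : Fin d →₀ ℕ) : ℂ :=
  MvPolynomial.coeff n (transitionPoly Q k)

/-! ### Hagedorn wave packets -/

/-- The momentum operator `p̂_j f = -i ħ ∂f/∂x_j`. -/
def momentum {d : ℕ} (ħ : ℝ) (j : Fin d) (f : (Fin d → ℝ) → ℂ) : (Fin d → ℝ) → ℂ :=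
  fun x => -Complex.I * (ħ : ℂ) * fderiv ℝ f x (Pi.single j 1)

/-- The `j`-th Hagedorn raising operator
`𝒜^*_j(S,z) = (i / √(2ħ)) [P^* (x̂ - q) - Q^* (p̂ - p)]_j`, where `z = (q, p)`. -/
def raising {d : ℕ} (ħ : ℝ) (S : Matrix (Fin d ⊕ Fin d) (Fin d ⊕ Fin d) ℝ) (q p : Fin d → ℝ)
    (j : Fin d) (f : (Fin d → ℝ) → ℂ) : (Fin d → ℝ) → ℂ :=
  fun x => Complex.I / (Real.sqrt (2 * ħ) : ℂ) *
    ((∑ l, (matP S).conjTranspose j l * (((x l - q l : ℝ) : ℂ) * f x)) -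
      ∑ l, (matQ S).conjTranspose j l * (momentum ħ l f x - (p l : ℂ) * f x))

/-- The Hagedorn ground state
`φ_0(S,z;x) = σ⁻¹ (πħ)^{-d/4} exp((i/ħ) [(x-q)ᵀ P Q⁻¹ (x-q) / 2 + p·(x-q)])`.
The parameter `σ` is the chosen square root of `det Q`. -/
def groundState {d : ℕ} (ħ : ℝ) (S : Matrix (Fin d ⊕ Fin d) (Fin d ⊕ Fin d) ℝ) (q p : Fin d → ℝ)
    (σ : ℂ) : (Fin d → ℝ) → ℂ :=
  fun x => σ⁻¹ / (((Real.pi * ħ) ^ ((d : ℝ) / 4) : ℝ) : ℂ) *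
    Complex.exp (Complex.I / (ħ : ℂ) *
      (1 / 2 * ∑ i, ∑ j, ((x i - q i : ℝ) : ℂ) * (matP S * (matQ S)⁻¹) i j *
          ((x j - q j : ℝ) : ℂ)
        + ∑ i, (p i : ℂ) * ((x i - q i : ℝ) : ℂ)))

/-- The Hagedorn wave packet
`φ_n = (n!)^{-1/2} (𝒜^*_1)^{n_1} ⋯ (𝒜^*_d)^{n_d} φ_0`. By `wavePacket_zero` and
`wavePacket_add_single` below, this is the family generated from `φ_0` by the recursion
`φ_{n+e_j} = (n_j+1)^{-1/2} 𝒜^*_j φ_n`. -/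
def wavePacket {d : ℕ} (ħ : ℝ) (S : Matrix (Fin d ⊕ Fin d) (Fin d ⊕ Fin d) ℝ) (q p : Fin d → ℝ)
    (σ : ℂ) (n : Fin d →₀ ℕ) : (Fin d → ℝ) → ℂ :=
  fun x => (Real.sqrt (multiFactorial n) : ℂ)⁻¹ *
    (List.finRange d).foldr (fun j f => (raising ħ S q p j)^[n j] f) (groundState ħ S q p σ) x

/-- The Hagedorn polynomial `𝒫_n(S,z;x) = c_n φ_n(S,z;x) / φ_0(S,z;x)`. -/
def hagedornPoly {d : ℕ} (ħ : ℝ) (S : Matrix (Fin d ⊕ Fin d) (Fin d ⊕ Fin d) ℝ) (q p : Fin d → ℝ)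
    (σ : ℂ) (n : Fin d →₀ ℕ) (x : Fin d → ℝ) : ℂ :=
  (normConst n : ℂ) * (wavePacket ħ S q p σ n x / groundState ħ S q p σ x)

/-! ### The recursion satisfied by the wave packets -/

theorem contDiff_groundState {d : ℕ} (ħ : ℝ) (S : Matrix (Fin d ⊕ Fin d) (Fin d ⊕ Fin d) ℝ)
    (q p : Fin d → ℝ) (σ : ℂ) : ContDiff ℝ (⊤ : ℕ∞) (groundState ħ S q p σ) := by
  unfold groundState
  have h : ∀ i, ContDiff ℝ (⊤ : ℕ∞) (fun x : Fin d → ℝ => ((x i - q i : ℝ) : ℂ)) := fun i =>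
    Complex.ofRealCLM.contDiff.comp ((contDiff_apply ℝ ℝ i).sub contDiff_const)
  refine contDiff_const.mul (Complex.contDiff_exp.comp (contDiff_const.mul
    ((contDiff_const.mul ?_).add ?_)))
  · exact ContDiff.sum fun i _ => ContDiff.sum fun j _ => ((h i).mul contDiff_const).mul (h j)
  · exact ContDiff.sum fun i _ => contDiff_const.mul (h i)

/-- `raising` as multiplication by an affine function plus a constant-coefficient derivation. -/
theorem raising_eq {d : ℕ} (ħ : ℝ) (S : Matrix (Fin d ⊕ Fin d) (Fin d ⊕ Fin d) ℝ)
    (q p : Fin d → ℝ) (j : Fin d) (f : (Fin d → ℝ) → ℂ) (x : Fin d → ℝ) :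
    raising ħ S q p j f x = Complex.I / (Real.sqrt (2 * ħ) : ℂ) *
      ((∑ l, ((matP S).conjTranspose j l * ((x l - q l : ℝ) : ℂ)
          + (matQ S).conjTranspose j l * (p l : ℂ))) * f x
        + Complex.I * ħ * ∑ l, (matQ S).conjTranspose j l * fderiv ℝ f x (Pi.single l 1)) := by
  unfold raising momentum
  congr 1
  rw [Finset.sum_mul, Finset.mul_sum, ← Finset.sum_sub_distrib, ← Finset.sum_add_distrib]
  refine Finset.sum_congr rfl fun l _ => ?_
  ring

theorem contDiff_fderiv_apply {d : ℕ} {f : (Fin d → ℝ) → ℂ} (hf : ContDiff ℝ (⊤ : ℕ∞) f)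
    (v : Fin d → ℝ) : ContDiff ℝ (⊤ : ℕ∞) (fun x => fderiv ℝ f x v) :=
  (hf.fderiv_right (m := (⊤ : ℕ∞)) (by simp)).clm_apply contDiff_const

theorem contDiff_raising {d : ℕ} (ħ : ℝ) (S : Matrix (Fin d ⊕ Fin d) (Fin d ⊕ Fin d) ℝ)
    (q p : Fin d → ℝ) (j : Fin d) {f : (Fin d → ℝ) → ℂ} (hf : ContDiff ℝ (⊤ : ℕ∞) f) :
    ContDiff ℝ (⊤ : ℕ∞) (raising ħ S q p j f) := by
  have h : ∀ i, ContDiff ℝ (⊤ : ℕ∞) (fun x : Fin d → ℝ => ((x i - q i : ℝ) : ℂ)) := fun i =>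
    Complex.ofRealCLM.contDiff.comp ((contDiff_apply ℝ ℝ i).sub contDiff_const)
  rw [show raising ħ S q p j f = _ from funext (raising_eq ħ S q p j f)]
  refine contDiff_const.mul (ContDiff.add (ContDiff.mul ?_ hf) (contDiff_const.mul ?_))
  · exact ContDiff.sum fun l _ => (contDiff_const.mul (h l)).add contDiff_const
  · exact ContDiff.sum fun l _ => contDiff_const.mul (contDiff_fderiv_apply hf _)

/-- The relation `Qᵀ P = Pᵀ Q` of a symplectic matrix. -/
theorem matQ_transpose_mul_matP {d : ℕ} {S : Matrix (Fin d ⊕ Fin d) (Fin d ⊕ Fin d) ℝ}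
    (hS : S ∈ Matrix.symplecticGroup (Fin d) ℝ) :
    (matQ S).transpose * matP S = (matP S).transpose * matQ S := by
  have h := SymplecticGroup.mem_iff'.1 hS
  have e : ∀ a b, ∑ l, (S (Sum.inr l) a * S (Sum.inl l) b - S (Sum.inl l) a * S (Sum.inr l) b)
      = Matrix.J (Fin d) ℝ a b := by
    intro a b
    rw [← h]
    simp [Matrix.mul_apply, Matrix.J, Fintype.sum_sum_type, Matrix.one_apply,
      sub_eq_add_neg, Finset.sum_add_distrib]
  have e11 := fun i j => e (Sum.inl i) (Sum.inl j)
  have e12 := fun i j => e (Sum.inl i) (Sum.inr j)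
  have e21 := fun i j => e (Sum.inr i) (Sum.inl j)
  have e22 := fun i j => e (Sum.inr i) (Sum.inr j)
  simp only [Matrix.J, Matrix.fromBlocks_apply₁₁, Matrix.fromBlocks_apply₁₂,
    Matrix.fromBlocks_apply₂₁, Matrix.fromBlocks_apply₂₂, Matrix.zero_apply] at e11 e12 e21 e22
  ext i j
  rw [← sub_eq_zero]
  have key : ((matQ S).transpose * matP S) i j - ((matP S).transpose * matQ S) i j
      = -((∑ l, (S (Sum.inr l) (Sum.inl i) * S (Sum.inl l) (Sum.inl j)
            - S (Sum.inl l) (Sum.inl i) * S (Sum.inr l) (Sum.inl j)) : ℝ) : ℂ)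
        + ((∑ l, (S (Sum.inr l) (Sum.inr i) * S (Sum.inl l) (Sum.inr j)
            - S (Sum.inl l) (Sum.inr i) * S (Sum.inr l) (Sum.inr j)) : ℝ) : ℂ)
        - Complex.I * (((∑ l, (S (Sum.inr l) (Sum.inl i) * S (Sum.inl l) (Sum.inr j)
            - S (Sum.inl l) (Sum.inl i) * S (Sum.inr l) (Sum.inr j)) : ℝ) : ℂ)
          + ((∑ l, (S (Sum.inr l) (Sum.inr i) * S (Sum.inl l) (Sum.inl j)
            - S (Sum.inl l) (Sum.inr i) * S (Sum.inr l) (Sum.inl j)) : ℝ) : ℂ)) := by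
    push_cast
    rw [Matrix.mul_apply, Matrix.mul_apply, ← Finset.sum_sub_distrib, ← Finset.sum_add_distrib,
      Finset.mul_sum, ← Finset.sum_neg_distrib, ← Finset.sum_add_distrib,
      ← Finset.sum_sub_distrib]
    refine Finset.sum_congr rfl fun l _ => ?_
    simp only [matQ, matP, Matrix.transpose_apply, Matrix.of_apply]
    linear_combination ((S (Sum.inl l) (Sum.inr i) : ℂ) * S (Sum.inr l) (Sum.inr j)
      - S (Sum.inr l) (Sum.inr i) * S (Sum.inl l) (Sum.inr j)) * Complex.I_sq
  rw [key, e11, e12, e21, e22]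
  simp

theorem fderiv_raising {d : ℕ} (ħ : ℝ) (S : Matrix (Fin d ⊕ Fin d) (Fin d ⊕ Fin d) ℝ)
    (q p : Fin d → ℝ) (j m : Fin d) {f : (Fin d → ℝ) → ℂ} (hf : ContDiff ℝ (⊤ : ℕ∞) f)
    (x : Fin d → ℝ) :
    fderiv ℝ (raising ħ S q p j f) x (Pi.single m 1) = Complex.I / (Real.sqrt (2 * ħ) : ℂ) *
      ((matP S).conjTranspose j m * f x
        + (∑ l, ((matP S).conjTranspose j l * ((x l - q l : ℝ) : ℂ)
          + (matQ S).conjTranspose j l * (p l : ℂ))) * fderiv ℝ f x (Pi.single m 1)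
        + Complex.I * ħ * ∑ l, (matQ S).conjTranspose j l *
            fderiv ℝ (fun y => fderiv ℝ f y (Pi.single l 1)) x (Pi.single m 1)) := by
  rw [show raising ħ S q p j f = _ from funext (raising_eq ħ S q p j f)]
  have h1 : ∀ l, HasFDerivAt (fun x : Fin d → ℝ => ((x l - q l : ℝ) : ℂ))
      (Complex.ofRealCLM.comp (ContinuousLinearMap.proj (R := ℝ) (φ := fun _ : Fin d => ℝ) l)) x :=
    fun l => Complex.ofRealCLM.hasFDerivAt.comp x ((hasFDerivAt_apply l x).sub_const (q l))
  have ha : HasFDerivAt (fun x : Fin d → ℝ => ∑ l, ((matP S).conjTranspose j l *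
      ((x l - q l : ℝ) : ℂ) + (matQ S).conjTranspose j l * (p l : ℂ))) _ x :=
    HasFDerivAt.fun_sum (u := Finset.univ) fun l _ =>
      ((h1 l).const_mul ((matP S).conjTranspose j l)).add_const
        ((matQ S).conjTranspose j l * (p l : ℂ))
  have hf' : HasFDerivAt f (fderiv ℝ f x) x := (hf.differentiable (by simp) x).hasFDerivAt
  have hD : HasFDerivAt (fun x => ∑ l, (matQ S).conjTranspose j l *
      fderiv ℝ f x (Pi.single l 1)) _ x :=
    HasFDerivAt.fun_sum (u := Finset.univ) fun l _ =>
      (((contDiff_fderiv_apply hf (Pi.single l 1)).differentiable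
        (by simp) x).hasFDerivAt).const_mul ((matQ S).conjTranspose j l)
  have hmain := ((ha.fun_mul hf').fun_add (hD.const_mul (Complex.I * ħ))).const_mul
    (Complex.I / (Real.sqrt (2 * ħ) : ℂ))
  rw [hmain.fderiv]
  have hs : ∑ l, star (matP S l j) * (((if l = m then 1 else 0 : ℝ)) : ℂ) = star (matP S m j) := by
    simp [apply_ite Complex.ofReal]
  simp only [RCLike.star_def] at hs
  simp [Pi.single_apply, hs]
  ring

/-- The raising operators commute on smooth functions. -/
theorem raising_comm {d : ℕ} (ħ : ℝ) {S : Matrix (Fin d ⊕ Fin d) (Fin d ⊕ Fin d) ℝ}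
    (hS : S ∈ Matrix.symplecticGroup (Fin d) ℝ) (q p : Fin d → ℝ) (i j : Fin d)
    {f : (Fin d → ℝ) → ℂ} (hf : ContDiff ℝ (⊤ : ℕ∞) f) :
    raising ħ S q p i (raising ħ S q p j f) = raising ħ S q p j (raising ħ S q p i f) := by
  funext x
  have hsymm : ∀ l m, fderiv ℝ (fun y => fderiv ℝ f y (Pi.single l 1)) x (Pi.single m 1)
      = fderiv ℝ (fun y => fderiv ℝ f y (Pi.single m 1)) x (Pi.single l 1) := by
    intro l m
    have hd : DifferentiableAt ℝ (fderiv ℝ f) x :=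
      (hf.fderiv_right (m := (⊤ : ℕ∞)) (by simp)).differentiable (by simp) x
    rw [fderiv_clm_apply hd (differentiableAt_const _),
      fderiv_clm_apply hd (differentiableAt_const _)]
    have := (hf.contDiffAt (x := x)).isSymmSndFDerivAt
      (by simpa using WithTop.coe_le_coe.2 (le_top : (2 : ℕ∞) ≤ ⊤))
    simpa using this (Pi.single m 1) (Pi.single l 1)
  have hrel : ∑ m, (matQ S).conjTranspose i m * (matP S).conjTranspose j m
      = ∑ m, (matQ S).conjTranspose j m * (matP S).conjTranspose i m := by
    have h := congrArg star (congrFun (congrFun (matQ_transpose_mul_matP hS) i) j)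
    simp only [Matrix.mul_apply, Matrix.transpose_apply, star_sum, star_mul'] at h
    simp only [Matrix.conjTranspose_apply]
    rw [h]
    exact Finset.sum_congr rfl fun m _ => mul_comm _ _
  have hdd : ∑ m, (matQ S).conjTranspose i m * ∑ l, (matQ S).conjTranspose j l *
        fderiv ℝ (fun y => fderiv ℝ f y (Pi.single l 1)) x (Pi.single m 1)
      = ∑ m, (matQ S).conjTranspose j m * ∑ l, (matQ S).conjTranspose i l *
        fderiv ℝ (fun y => fderiv ℝ f y (Pi.single l 1)) x (Pi.single m 1) := by
    simp only [Finset.mul_sum]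
    rw [Finset.sum_comm]
    refine Finset.sum_congr rfl fun l _ => Finset.sum_congr rfl fun m _ => ?_
    rw [hsymm l m]
    ring
  have expand : ∀ a b : Fin d, ∑ m, (matQ S).conjTranspose a m *
      fderiv ℝ (raising ħ S q p b f) x (Pi.single m 1)
      = Complex.I / (Real.sqrt (2 * ħ) : ℂ) *
        ((∑ m, (matQ S).conjTranspose a m * (matP S).conjTranspose b m) * f x
        + (∑ l, ((matP S).conjTranspose b l * ((x l - q l : ℝ) : ℂ)
          + (matQ S).conjTranspose b l * (p l : ℂ))) *
          ∑ m, (matQ S).conjTranspose a m * fderiv ℝ f x (Pi.single m 1)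
        + Complex.I * ħ * ∑ m, (matQ S).conjTranspose a m * ∑ l, (matQ S).conjTranspose b l *
            fderiv ℝ (fun y => fderiv ℝ f y (Pi.single l 1)) x (Pi.single m 1)) := by
    intro a b
    generalize hA : (∑ l, ((matP S).conjTranspose b l * ((x l - q l : ℝ) : ℂ)
          + (matQ S).conjTranspose b l * (p l : ℂ))) = A
    rw [Finset.sum_mul, Finset.mul_sum, Finset.mul_sum, ← Finset.sum_add_distrib,
      ← Finset.sum_add_distrib, Finset.mul_sum]
    refine Finset.sum_congr rfl fun m _ => ?_
    rw [fderiv_raising ħ S q p b m hf x, hA]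
    ring
  rw [raising_eq ħ S q p i (raising ħ S q p j f), raising_eq ħ S q p j (raising ħ S q p i f),
    expand i j, expand j i, raising_eq ħ S q p j f, raising_eq ħ S q p i f, hrel, hdd]
  ring

theorem contDiff_iterate_raising {d : ℕ} (ħ : ℝ) (S : Matrix (Fin d ⊕ Fin d) (Fin d ⊕ Fin d) ℝ)
    (q p : Fin d → ℝ) (j : Fin d) (m : ℕ) {f : (Fin d → ℝ) → ℂ} (hf : ContDiff ℝ (⊤ : ℕ∞) f) :
    ContDiff ℝ (⊤ : ℕ∞) ((raising ħ S q p j)^[m] f) := by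
  induction m with
  | zero => exact hf
  | succ m ih =>
    rw [Function.iterate_succ_apply']
    exact contDiff_raising ħ S q p j ih

theorem iterate_raising_comm {d : ℕ} (ħ : ℝ) {S : Matrix (Fin d ⊕ Fin d) (Fin d ⊕ Fin d) ℝ}
    (hS : S ∈ Matrix.symplecticGroup (Fin d) ℝ) (q p : Fin d → ℝ) (i j : Fin d) (m : ℕ)
    {f : (Fin d → ℝ) → ℂ} (hf : ContDiff ℝ (⊤ : ℕ∞) f) :
    (raising ħ S q p i)^[m] (raising ħ S q p j f)
      = raising ħ S q p j ((raising ħ S q p i)^[m] f) := by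
  induction m with
  | zero => rfl
  | succ m ih =>
    rw [Function.iterate_succ_apply', Function.iterate_succ_apply', ih,
      raising_comm ħ hS q p i j (contDiff_iterate_raising ħ S q p i m hf)]

theorem contDiff_foldr_raising {d : ℕ} (ħ : ℝ) (S : Matrix (Fin d ⊕ Fin d) (Fin d ⊕ Fin d) ℝ)
    (q p : Fin d → ℝ) (n : Fin d →₀ ℕ) (l : List (Fin d)) {f : (Fin d → ℝ) → ℂ}
    (hf : ContDiff ℝ (⊤ : ℕ∞) f) :
    ContDiff ℝ (⊤ : ℕ∞) (l.foldr (fun j f => (raising ħ S q p j)^[n j] f) f) := by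
  induction l with
  | nil => exact hf
  | cons a l ih => exact contDiff_iterate_raising ħ S q p a (n a) ih

theorem foldr_raising_add_single {d : ℕ} (ħ : ℝ)
    {S : Matrix (Fin d ⊕ Fin d) (Fin d ⊕ Fin d) ℝ}
    (hS : S ∈ Matrix.symplecticGroup (Fin d) ℝ) (q p : Fin d → ℝ) (n : Fin d →₀ ℕ) (j : Fin d)
    {f : (Fin d → ℝ) → ℂ} (hf : ContDiff ℝ (⊤ : ℕ∞) f) (l : List (Fin d)) (hl : l.Nodup) :
    l.foldr (fun i g => (raising ħ S q p i)^[(n + Finsupp.single j 1 : Fin d →₀ ℕ) i] g) f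
      = if j ∈ l then raising ħ S q p j (l.foldr (fun i g => (raising ħ S q p i)^[n i] g) f)
        else l.foldr (fun i g => (raising ħ S q p i)^[n i] g) f := by
  induction l with
  | nil => simp
  | cons a l ih =>
    have ih' := ih (List.nodup_cons.1 hl).2
    have hc := contDiff_foldr_raising ħ S q p n l hf
    simp only [List.foldr_cons]
    rw [ih']
    by_cases haj : a = j
    · subst haj
      have hnot := (List.nodup_cons.1 hl).1
      rw [if_neg hnot, if_pos List.mem_cons_self]
      simp [Function.iterate_succ_apply']
    · have h0 : (n + Finsupp.single j 1 : Fin d →₀ ℕ) a = n a := by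
        simp [Ne.symm haj]
      rw [h0]
      by_cases hj : j ∈ l
      · rw [if_pos hj, if_pos (List.mem_cons_of_mem _ hj), iterate_raising_comm ħ hS q p a j _ hc]
      · rw [if_neg hj, if_neg]
        simp [hj, Ne.symm haj]

theorem raising_const_mul {d : ℕ} (ħ : ℝ) (S : Matrix (Fin d ⊕ Fin d) (Fin d ⊕ Fin d) ℝ)
    (q p : Fin d → ℝ) (j : Fin d) (c : ℂ) {f : (Fin d → ℝ) → ℂ} (hf : ContDiff ℝ (⊤ : ℕ∞) f)
    (x : Fin d → ℝ) :
    raising ħ S q p j (fun y => c * f y) x = c * raising ħ S q p j f x := by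
  rw [raising_eq, raising_eq, fderiv_const_mul (hf.differentiable (by simp) x)]
  simp only [smul_apply, smul_eq_mul]
  have : ∑ l, (matQ S).conjTranspose j l * (c * fderiv ℝ f x (Pi.single l 1))
      = c * ∑ l, (matQ S).conjTranspose j l * fderiv ℝ f x (Pi.single l 1) := by
    rw [Finset.mul_sum]
    exact Finset.sum_congr rfl fun l _ => by ring
  rw [this]
  ring

theorem multiFactorial_add_single {d : ℕ} (n : Fin d →₀ ℕ) (j : Fin d) :
    multiFactorial (n + Finsupp.single j 1) = (n j + 1) * multiFactorial n := by
  unfold multiFactorial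
  rw [← Finset.mul_prod_erase _ _ (Finset.mem_univ j), ← Finset.mul_prod_erase Finset.univ
    (fun i => (n i).factorial) (Finset.mem_univ j), ← mul_assoc]
  congr 1
  · simp [Nat.factorial_succ]
  · refine Finset.prod_congr rfl fun i hi => ?_
    simp [Ne.symm (Finset.ne_of_mem_erase hi)]

theorem wavePacket_zero {d : ℕ} (ħ : ℝ) (S : Matrix (Fin d ⊕ Fin d) (Fin d ⊕ Fin d) ℝ)
    (q p : Fin d → ℝ) (σ : ℂ) : wavePacket ħ S q p σ 0 = groundState ħ S q p σ := by
  funext x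
  have : ∀ l : List (Fin d), l.foldr (fun j f => (raising ħ S q p j)^[(0 : Fin d →₀ ℕ) j] f)
      (groundState ħ S q p σ) = groundState ħ S q p σ := by
    intro l
    induction l with
    | nil => rfl
    | cons a l ih => simp
  simp [wavePacket, multiFactorial]

/-- The recursion `φ_{n+e_j} = (n_j+1)^{-1/2} 𝒜^*_j φ_n`. -/
theorem wavePacket_add_single {d : ℕ} (ħ : ℝ) {S : Matrix (Fin d ⊕ Fin d) (Fin d ⊕ Fin d) ℝ}
    (hS : S ∈ Matrix.symplecticGroup (Fin d) ℝ) (q p : Fin d → ℝ) (σ : ℂ) (n : Fin d →₀ ℕ)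
    (j : Fin d) (x : Fin d → ℝ) :
    wavePacket ħ S q p σ (n + Finsupp.single j 1) x
      = (Real.sqrt (n j + 1) : ℂ)⁻¹ * raising ħ S q p j (wavePacket ħ S q p σ n) x := by
  have hg := contDiff_groundState ħ S q p σ
  unfold wavePacket
  rw [raising_const_mul ħ S q p j _ (contDiff_foldr_raising ħ S q p n _ hg),
    foldr_raising_add_single ħ hS q p n j hg _ (List.nodup_finRange d),
    if_pos (List.mem_finRange j), multiFactorial_add_single]
  push_cast
  rw [Real.sqrt_mul (by positivity)]
  push_cast
  rw [mul_inv, mul_assoc]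

end Hagedorn

end

open Hagedorn

noncomputable section

namespace Hagedorn

/-! Both sides of the expansion equal `1` at `n = 0` and obey the same raising recursion, so they
agree by induction on `|n|`. Conjugating the raising operator by the Gaussian ground state turns it
into `g ↦ (2/√ħ) (Q⁻¹(x-q))_j g - √ħ (Q^* ∇g)_j`, up to a factor that the normalisation of `𝒫_n`
absorbs (`raising_groundState_mul`, `hagedornPoly_add_single`). The symplectic relations enter here:
`P Q⁻¹` is symmetric and `P^* - Q^* P Q⁻¹ = -2i Q⁻¹`. Put `U = |Q|⁻¹ Q̄` and `y = |Q|⁻¹(x-q)`. Since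
`Uᵀ |Q|⁻¹ = Q⁻¹` (`transition_transpose_mul`), and since `Q^* ∇_x` becomes `Uᵀ ∇_y` by the chain
rule, the same operator reads `∑ i, U_{ij} (2 y_i/√ħ - √ħ ∂_{y_i})`. Each bracket sends `p_k` to
`p_{k+e_i}`. On the coefficient side, differentiating `(Uw)^k` in `w_j` gives a recursion for
`f^k_n` (`transitionCoeff_add_single`) which, weighted by `n!/k!`, is exactly this action
(`hermiteCombination_add_single`). -/

/-! ### The matrices `Q`, `P` and `|Q|` of a symplectic matrix -/

/-- The relation `Q^* P - P^* Q = 2i` of a symplectic matrix. -/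
theorem matQ_conjTranspose_mul_matP {d : ℕ} {S : Matrix (Fin d ⊕ Fin d) (Fin d ⊕ Fin d) ℝ}
    (hS : S ∈ Matrix.symplecticGroup (Fin d) ℝ) :
    (matQ S).conjTranspose * matP S - (matP S).conjTranspose * matQ S
      = (2 * Complex.I) • (1 : Matrix (Fin d) (Fin d) ℂ) := by
  have h := SymplecticGroup.mem_iff'.1 hS
  have e : ∀ a b, ∑ l, (S (Sum.inr l) a * S (Sum.inl l) b - S (Sum.inl l) a * S (Sum.inr l) b)
      = Matrix.J (Fin d) ℝ a b := by
    intro a b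
    rw [← h]
    simp [Matrix.mul_apply, Matrix.J, Fintype.sum_sum_type, Matrix.one_apply,
      sub_eq_add_neg, Finset.sum_add_distrib]
  have e11 := fun i j => e (Sum.inl i) (Sum.inl j)
  have e12 := fun i j => e (Sum.inl i) (Sum.inr j)
  have e21 := fun i j => e (Sum.inr i) (Sum.inl j)
  have e22 := fun i j => e (Sum.inr i) (Sum.inr j)
  simp only [Matrix.J, Matrix.fromBlocks_apply₁₁, Matrix.fromBlocks_apply₁₂,
    Matrix.fromBlocks_apply₂₁, Matrix.fromBlocks_apply₂₂, Matrix.zero_apply] at e11 e12 e21 e22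
  ext i j
  -- The real part collects the two diagonal blocks of `Sᵀ J S = J`, which vanish; the imaginary
  -- part collects the two off-diagonal blocks, and each contributes one identity to `2i`.
  have key : ((matQ S).conjTranspose * matP S - (matP S).conjTranspose * matQ S) i j
      = -((∑ l, (S (Sum.inr l) (Sum.inl i) * S (Sum.inl l) (Sum.inl j)
            - S (Sum.inl l) (Sum.inl i) * S (Sum.inr l) (Sum.inl j)) : ℝ) : ℂ)
        - ((∑ l, (S (Sum.inr l) (Sum.inr i) * S (Sum.inl l) (Sum.inr j)
            - S (Sum.inl l) (Sum.inr i) * S (Sum.inr l) (Sum.inr j)) : ℝ) : ℂ)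
        - Complex.I * (((∑ l, (S (Sum.inr l) (Sum.inl i) * S (Sum.inl l) (Sum.inr j)
            - S (Sum.inl l) (Sum.inl i) * S (Sum.inr l) (Sum.inr j)) : ℝ) : ℂ)
          - ((∑ l, (S (Sum.inr l) (Sum.inr i) * S (Sum.inl l) (Sum.inl j)
            - S (Sum.inl l) (Sum.inr i) * S (Sum.inr l) (Sum.inl j)) : ℝ) : ℂ)) := by
    push_cast
    rw [Matrix.sub_apply, Matrix.mul_apply, Matrix.mul_apply, ← Finset.sum_sub_distrib,
      ← Finset.sum_sub_distrib, Finset.mul_sum, ← Finset.sum_neg_distrib,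
      ← Finset.sum_sub_distrib, ← Finset.sum_sub_distrib]
    refine Finset.sum_congr rfl fun l _ => ?_
    simp only [matQ, matP, Matrix.conjTranspose_apply, Matrix.of_apply, star_add, star_mul',
      RCLike.star_def, Complex.conj_ofReal, Complex.conj_I]
    linear_combination ((S (Sum.inr l) (Sum.inr i) : ℂ) * S (Sum.inl l) (Sum.inr j)
      - S (Sum.inl l) (Sum.inr i) * S (Sum.inr l) (Sum.inr j)) * Complex.I_sq
  rw [key, e11, e12, e21, e22]
  by_cases hij : i = j
  · subst hij
    simp
    ring
  · simp [hij]

/-- The matrix `Q Q^*` of a symplectic matrix is symmetric. -/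
theorem transpose_matQ_mul_conjTranspose {d : ℕ} {S : Matrix (Fin d ⊕ Fin d) (Fin d ⊕ Fin d) ℝ}
    (hS : S ∈ Matrix.symplecticGroup (Fin d) ℝ) :
    (matQ S * (matQ S).conjTranspose).transpose = matQ S * (matQ S).conjTranspose := by
  have h := SymplecticGroup.mem_iff.1 hS
  have e : ∀ i j, ∑ l, (S (Sum.inl i) (Sum.inr l) * S (Sum.inl j) (Sum.inl l)
      - S (Sum.inl i) (Sum.inl l) * S (Sum.inl j) (Sum.inr l)) = 0 := by
    intro i j
    have := congrFun (congrFun h (Sum.inl i)) (Sum.inl j)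
    simpa [Matrix.mul_apply, Matrix.J, Fintype.sum_sum_type, Matrix.one_apply,
      sub_eq_add_neg, Finset.sum_add_distrib] using this
  ext i j
  rw [← sub_eq_zero]
  -- The antisymmetric part of `Q Q^*` is a multiple of `B Aᵀ - A Bᵀ`, which is zero by the upper
  -- left block of `S J Sᵀ = J`.
  have key : (matQ S * (matQ S).conjTranspose).transpose i j - (matQ S * (matQ S).conjTranspose) i j
      = -2 * Complex.I * ((∑ l, (S (Sum.inl i) (Sum.inr l) * S (Sum.inl j) (Sum.inl l)
      - S (Sum.inl i) (Sum.inl l) * S (Sum.inl j) (Sum.inr l)) : ℝ) : ℂ) := by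
    push_cast
    rw [Matrix.transpose_apply, Matrix.mul_apply, Matrix.mul_apply, ← Finset.sum_sub_distrib,
      Finset.mul_sum]
    refine Finset.sum_congr rfl fun l _ => ?_
    simp only [matQ, Matrix.conjTranspose_apply, Matrix.of_apply, star_add, star_mul',
      RCLike.star_def, Complex.conj_ofReal, Complex.conj_I]
    ring
  rw [key, e]
  simp

/-- If `Qv = 0`, then pairing `Q^* P - P^* Q = 2i` with `v` on both sides gives `0 = 2i |v|²`. -/
theorem det_matQ_ne_zero {d : ℕ} {S : Matrix (Fin d ⊕ Fin d) (Fin d ⊕ Fin d) ℝ}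
    (hS : S ∈ Matrix.symplecticGroup (Fin d) ℝ) : (matQ S).det ≠ 0 := by
  intro h0
  obtain ⟨v, hv, hQv⟩ := Matrix.exists_mulVec_eq_zero_iff.2 h0
  have h := congrArg (fun M => dotProduct (star v) (M.mulVec v)) (matQ_conjTranspose_mul_matP hS)
  simp only [Matrix.sub_mulVec, ← Matrix.mulVec_mulVec, hQv, Matrix.mulVec_zero, sub_zero,
    Matrix.smul_mulVec, Matrix.one_mulVec, dotProduct_smul] at h
  rw [Matrix.dotProduct_mulVec, ← Matrix.star_mulVec, hQv] at h
  have : star v ⬝ᵥ v = 0 := by simpa using h.symm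
  exact hv (dotProduct_star_self_eq_zero.1 this)

theorem absMat_mul_self {d : ℕ} (Q : Matrix (Fin d) (Fin d) ℂ) :
    absMat Q * absMat Q = Q * Q.conjTranspose :=
  CFC.sqrt_mul_sqrt_self _ (Matrix.posSemidef_self_mul_conjTranspose Q).nonneg

/-- Uniqueness of the positive semidefinite square root: the transpose is again positive
semidefinite, and its square is `(Q Q^*)ᵀ = Q Q^*`. -/
theorem transpose_absMat_matQ {d : ℕ} {S : Matrix (Fin d ⊕ Fin d) (Fin d ⊕ Fin d) ℝ}
    (hS : S ∈ Matrix.symplecticGroup (Fin d) ℝ) :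
    (absMat (matQ S)).transpose = absMat (matQ S) := by
  refine (CFC.sqrt_unique ?_ ?_).symm
  · rw [← Matrix.transpose_mul, absMat_mul_self, transpose_matQ_mul_conjTranspose hS]
  · exact (Matrix.nonneg_iff_posSemidef.1 (CFC.sqrt_nonneg _)).transpose.nonneg

/-- `(|Q|⁻¹ Q̄)ᵀ |Q|⁻¹ = Q⁻¹` for the matrix `Q` of a symplectic matrix. -/
theorem transition_transpose_mul {d : ℕ} {S : Matrix (Fin d ⊕ Fin d) (Fin d ⊕ Fin d) ℝ}
    (hS : S ∈ Matrix.symplecticGroup (Fin d) ℝ) :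
    ((absMat (matQ S))⁻¹ * (matQ S).map (starRingEnd ℂ)).transpose * (absMat (matQ S))⁻¹
      = (matQ S)⁻¹ := by
  have hu : IsUnit (matQ S).det := (det_matQ_ne_zero hS).isUnit
  have huc : IsUnit (matQ S).conjTranspose.det := by
    rw [Matrix.det_conjTranspose]; exact hu.star
  have hc : ((matQ S).map (starRingEnd ℂ)).transpose = (matQ S).conjTranspose := rfl
  -- By symmetry of `|Q|` the left side is `Q^* |Q|⁻¹ |Q|⁻¹ = Q^* (Q Q^*)⁻¹`.
  rw [Matrix.transpose_mul, Matrix.transpose_nonsing_inv, transpose_absMat_matQ hS, hc,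
    Matrix.mul_assoc, ← Matrix.mul_inv_rev, absMat_mul_self, Matrix.mul_inv_rev,
    Matrix.mul_nonsing_inv_cancel_left _ _ huc]

/-- `(P^* - Q^* P Q⁻¹) = -2i Q⁻¹`. -/
theorem matP_conjTranspose_sub {d : ℕ} {S : Matrix (Fin d ⊕ Fin d) (Fin d ⊕ Fin d) ℝ}
    (hS : S ∈ Matrix.symplecticGroup (Fin d) ℝ) :
    (matP S).conjTranspose - (matQ S).conjTranspose * (matP S * (matQ S)⁻¹)
      = (-(2 * Complex.I)) • (matQ S)⁻¹ := by
  have hu : IsUnit (matQ S).det := (det_matQ_ne_zero hS).isUnit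
  have h := congrArg (fun M => -(M * (matQ S)⁻¹)) (matQ_conjTranspose_mul_matP hS)
  simp only [Matrix.sub_mul, Matrix.mul_nonsing_inv_cancel_right _ _ hu, neg_sub,
    Matrix.smul_mul, Matrix.one_mul, Matrix.mul_assoc] at h
  rw [neg_smul, ← h]

/-- The matrix `P Q⁻¹` of a symplectic matrix is symmetric. -/
theorem transpose_matP_mul_inv {d : ℕ} {S : Matrix (Fin d ⊕ Fin d) (Fin d ⊕ Fin d) ℝ}
    (hS : S ∈ Matrix.symplecticGroup (Fin d) ℝ) :
    (matP S * (matQ S)⁻¹).transpose = matP S * (matQ S)⁻¹ := by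
  have hu : IsUnit (matQ S).det := (det_matQ_ne_zero hS).isUnit
  have hut : IsUnit (matQ S).transpose.det := by rwa [Matrix.det_transpose]
  have h := congrArg (fun M => (matQ S).transpose⁻¹ * M * (matQ S)⁻¹) (matQ_transpose_mul_matP hS)
  simp only [Matrix.nonsing_inv_mul_cancel_left _ _ hut] at h
  refine Eq.trans ?_ h.symm
  rw [Matrix.transpose_mul, Matrix.transpose_nonsing_inv, ← Matrix.mul_assoc,
    Matrix.mul_nonsing_inv_cancel_right _ _ hu]

/-! ### The transition polynomials -/

theorem transitionPoly_isHomogeneous {d : ℕ} (Q : Matrix (Fin d) (Fin d) ℂ) (k : Fin d →₀ ℕ) :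
    (transitionPoly Q k).IsHomogeneous k.degree := by
  rw [Finsupp.degree_eq_sum]
  refine MvPolynomial.IsHomogeneous.prod _ _ _ fun i _ => ?_
  have h := (MvPolynomial.IsHomogeneous.sum Finset.univ
    (fun j => MvPolynomial.C (((absMat Q)⁻¹ * Q.map (starRingEnd ℂ)) i j) *
      (MvPolynomial.X j : MvPolynomial (Fin d) ℂ)) 1
    fun j _ => MvPolynomial.isHomogeneous_C_mul_X _ j).pow (k i)
  rwa [one_mul] at h

theorem transitionCoeff_eq_zero {d : ℕ} (Q : Matrix (Fin d) (Fin d) ℂ) {k n : Fin d →₀ ℕ}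
    (h : k.degree ≠ n.degree) : transitionCoeff Q k n = 0 :=
  (transitionPoly_isHomogeneous Q k).coeff_eq_zero h.symm

theorem mem_finsuppAntidiag_univ {d N : ℕ} {n : Fin d →₀ ℕ} :
    n ∈ Finset.univ.finsuppAntidiag N ↔ n.degree = N := by
  simp [Finset.mem_finsuppAntidiag, Finsupp.degree_eq_sum]

theorem prod_mulVec_pow_eq_sum_transitionCoeff {d : ℕ} (Q : Matrix (Fin d) (Fin d) ℂ)
    (k : Fin d →₀ ℕ) (w : Fin d → ℂ) :
    ∏ i, (((absMat Q)⁻¹ * Q.map (starRingEnd ℂ)).mulVec w) i ^ k i =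
      ∑ n ∈ Finset.univ.finsuppAntidiag k.degree, transitionCoeff Q k n * ∏ j, w j ^ n j := by
  have h : MvPolynomial.eval w (transitionPoly Q k)
      = ∏ i, (((absMat Q)⁻¹ * Q.map (starRingEnd ℂ)).mulVec w) i ^ k i := by
    simp [transitionPoly, Matrix.mulVec, dotProduct]
  rw [← h, MvPolynomial.eval_eq']
  -- Evaluation sums over the support only; homogeneity places the support inside the multi-indices
  -- of degree `|k|`, and the added terms have coefficient zero.
  refine Finset.sum_subset (fun n hn => ?_) fun n _ hn => ?_
  · rw [mem_finsuppAntidiag_univ]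
    by_contra hne
    exact MvPolynomial.mem_support_iff.1 hn (transitionCoeff_eq_zero Q (Ne.symm hne))
  · rw [MvPolynomial.notMem_support_iff.1 hn, zero_mul]

theorem pderiv_prod {σ ι R : Type*} [CommSemiring R] [DecidableEq ι] (j : σ) (s : Finset ι)
    (f : ι → MvPolynomial σ R) :
    MvPolynomial.pderiv j (∏ i ∈ s, f i)
      = ∑ i ∈ s, MvPolynomial.pderiv j (f i) * ∏ l ∈ s.erase i, f l := by
  induction s using Finset.induction_on with
  | empty => simp
  | insert a s ha ih =>
    rw [Finset.prod_insert ha, MvPolynomial.pderiv_mul, ih, Finset.sum_insert ha,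
      Finset.erase_insert ha, Finset.mul_sum]
    congr 1
    refine Finset.sum_congr rfl fun i hi => ?_
    have hne : a ≠ i := fun h => ha (h ▸ hi)
    rw [Finset.erase_insert_of_ne hne, Finset.prod_insert (fun h => ha (Finset.mem_of_mem_erase h))]
    ring

/-- Leibniz rule for a product of powers of linear forms. For `k i = 0` the truncated `k - e_i` is
`k` itself, but the factor `k i` kills that term. -/
theorem pderiv_transitionPoly {d : ℕ} (Q : Matrix (Fin d) (Fin d) ℂ) (k : Fin d →₀ ℕ)
    (j : Fin d) :
    MvPolynomial.pderiv j (transitionPoly Q k)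
      = ∑ i, MvPolynomial.C ((k i : ℂ) * ((absMat Q)⁻¹ * Q.map (starRingEnd ℂ)) i j) *
          transitionPoly Q (k - Finsupp.single i 1) := by
  unfold transitionPoly
  rw [pderiv_prod]
  refine Finset.sum_congr rfl fun i _ => ?_
  conv_rhs => rw [← Finset.mul_prod_erase Finset.univ _ (Finset.mem_univ i)]
  have h1 : ∀ l ∈ Finset.univ.erase i, (k - Finsupp.single i 1 : Fin d →₀ ℕ) l = k l := fun l hl => by
    simp [Ne.symm (Finset.ne_of_mem_erase hl)]
  conv_rhs => rw [Finset.prod_congr rfl fun l hl => by rw [h1 l hl]]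
  rw [MvPolynomial.pderiv_pow]
  have h2 : MvPolynomial.pderiv j (∑ l, MvPolynomial.C
      (((absMat Q)⁻¹ * Q.map (starRingEnd ℂ)) i l) * (MvPolynomial.X l : MvPolynomial (Fin d) ℂ))
      = MvPolynomial.C (((absMat Q)⁻¹ * Q.map (starRingEnd ℂ)) i j) := by
    simp [MvPolynomial.pderiv_X, Pi.single_apply]
  rw [h2]
  simp only [Finsupp.coe_tsub, Pi.sub_apply, Finsupp.single_eq_same, map_mul, map_natCast]
  ring

/-- `(n_j + 1) f^k_{n + e_j} = ∑ i, k_i U_{ij} f^{k - e_i}_n` for `U = |Q|⁻¹ Q̄`. -/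
theorem transitionCoeff_add_single {d : ℕ} (Q : Matrix (Fin d) (Fin d) ℂ) (k n : Fin d →₀ ℕ)
    (j : Fin d) :
    transitionCoeff Q k (n + Finsupp.single j 1) * (n j + 1)
      = ∑ i, (k i : ℂ) * ((absMat Q)⁻¹ * Q.map (starRingEnd ℂ)) i j *
          transitionCoeff Q (k - Finsupp.single i 1) n := by
  unfold transitionCoeff
  rw [← MvPolynomial.coeff_pderiv, pderiv_transitionPoly, MvPolynomial.coeff_sum]
  simp only [MvPolynomial.coeff_C_mul]

theorem transitionPoly_zero {d : ℕ} (Q : Matrix (Fin d) (Fin d) ℂ) : transitionPoly Q 0 = 1 := by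
  simp [transitionPoly]

/-! ### Scaled Hermite polynomials and their combinations -/

theorem multiFactorial_ne_zero {d : ℕ} (n : Fin d →₀ ℕ) : multiFactorial n ≠ 0 :=
  Finset.prod_ne_zero_iff.2 fun j _ => Nat.factorial_ne_zero (n j)

theorem scaledHermite_zero {d : ℕ} (ħ : ℝ) (y : Fin d → ℂ) : scaledHermite ħ 0 y = 1 := by
  simp [scaledHermite, hermitePoly]

/-- The one-variable recursion acts on the `i`-th factor alone. The derivative term is left
unevaluated so that it can be eliminated when the product is differentiated. -/
theorem scaledHermite_add_single {d : ℕ} (ħ : ℝ) (k : Fin d →₀ ℕ) (i : Fin d) (y : Fin d → ℂ) :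
    scaledHermite ħ (k + Finsupp.single i 1) y
      = 2 * (y i / (Real.sqrt ħ : ℂ)) * scaledHermite ħ k y
        - Polynomial.aeval (y i / (Real.sqrt ħ : ℂ)) (hermitePoly (k i)).derivative
          * ∏ l ∈ Finset.univ.erase i,
            Polynomial.aeval (y l / (Real.sqrt ħ : ℂ)) (hermitePoly (k l)) := by
  unfold scaledHermite
  rw [← Finset.mul_prod_erase _ _ (Finset.mem_univ i), ← Finset.mul_prod_erase Finset.univ
    (fun l => Polynomial.aeval (y l / (Real.sqrt ħ : ℂ)) (hermitePoly (k l))) (Finset.mem_univ i)]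
  have h1 : ∀ l ∈ Finset.univ.erase i, (k + Finsupp.single i 1 : Fin d →₀ ℕ) l = k l := fun l hl => by
    simp [Ne.symm (Finset.ne_of_mem_erase hl)]
  rw [Finset.prod_congr rfl fun l hl => by rw [h1 l hl]]
  simp only [Finsupp.coe_add, Pi.add_apply, Finsupp.single_eq_same, hermitePoly, map_sub, map_mul,
    Polynomial.aeval_X, map_ofNat]
  ring

/-- The defining recursion `H_{m+1} = 2t H_m - H_m'` is solved for `H_m'`, so the identity `H_m' =
2m H_{m-1}` is never needed. -/
theorem hasFDerivAt_scaledHermite {d : ℕ} {E : Type*} [NormedAddCommGroup E] [NormedSpace ℝ E]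
    (ħ : ℝ) (k : Fin d →₀ ℕ) {y : E → Fin d → ℂ} {y' : Fin d → E →L[ℝ] ℂ} {x : E}
    (hy : ∀ i, HasFDerivAt (fun x => y x i) (y' i) x) :
    HasFDerivAt (fun x => scaledHermite ħ k (y x))
      (∑ i, ((Real.sqrt ħ : ℂ)⁻¹ * (2 * (y x i / (Real.sqrt ħ : ℂ)) * scaledHermite ħ k (y x)
        - scaledHermite ħ (k + Finsupp.single i 1) (y x))) • y' i) x := by
  have h1 : ∀ i ∈ Finset.univ, HasFDerivAt
      (fun x => Polynomial.aeval (y x i / (Real.sqrt ħ : ℂ)) (hermitePoly (k i)))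
      (Polynomial.aeval (y x i / (Real.sqrt ħ : ℂ)) (hermitePoly (k i)).derivative •
        ((Real.sqrt ħ : ℂ)⁻¹ • y' i)) x := fun i _ => by
    have h2 : HasFDerivAt (fun x => y x i / (Real.sqrt ħ : ℂ)) ((Real.sqrt ħ : ℂ)⁻¹ • y' i) x := by
      simp only [div_eq_inv_mul]
      exact (hy i).const_mul _
    exact (Polynomial.hasDerivAt_aeval (hermitePoly (k i)) _).comp_hasFDerivAt x h2
  refine (HasFDerivAt.finsetProd h1).congr_fderiv (Finset.sum_congr rfl fun i _ => ?_)
  rw [scaledHermite_add_single, sub_sub_cancel, smul_smul, smul_smul]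
  congr 1
  ring

/-- The combination `∑_{|k| = |n|} (n!/k!) f^k_n(Q) p_k` of scaled Hermite polynomials. -/
def hermiteCombination {d : ℕ} (ħ : ℝ) (Q : Matrix (Fin d) (Fin d) ℂ) (n : Fin d →₀ ℕ)
    (y : Fin d → ℂ) : ℂ :=
  ∑ k ∈ Finset.univ.finsuppAntidiag n.degree,
    (multiFactorial n : ℂ) / (multiFactorial k : ℂ) * transitionCoeff Q k n * scaledHermite ħ k y

theorem hermiteCombination_zero {d : ℕ} (ħ : ℝ) (Q : Matrix (Fin d) (Fin d) ℂ) (y : Fin d → ℂ) :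
    hermiteCombination ħ Q 0 y = 1 := by
  simp [hermiteCombination, transitionCoeff, transitionPoly_zero, scaledHermite_zero,
    multiFactorial]

/-- Reindexing: `k ↦ k + e_i` is a bijection from degree `N` onto the multi-indices of degree `N +
1` with `k i ≠ 0`. -/
theorem sum_finsuppAntidiag_succ {d N : ℕ} (i : Fin d) (F : (Fin d →₀ ℕ) → ℂ) :
    ∑ k ∈ Finset.univ.finsuppAntidiag (N + 1), (if k i = 0 then 0 else F k)
      = ∑ k ∈ Finset.univ.finsuppAntidiag N, F (k + Finsupp.single i 1) := by
  symm
  refine Finset.sum_of_injOn (fun k => k + Finsupp.single i 1)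
    (fun a _ b _ h => add_right_cancel h) ?_ ?_ ?_
  · intro k hk
    have hk' := mem_finsuppAntidiag_univ.1 (Finset.mem_coe.1 hk)
    exact Finset.mem_coe.2 (mem_finsuppAntidiag_univ.2 (by simp [hk']))
  · intro k hk hnot
    rw [if_pos]
    by_contra h0
    have hle : Finsupp.single i 1 ≤ k := by simpa using Nat.one_le_iff_ne_zero.2 h0
    refine hnot ⟨k - Finsupp.single i 1, Finset.mem_coe.2 (mem_finsuppAntidiag_univ.2 ?_),
      tsub_add_cancel_of_le hle⟩
    have h1 := mem_finsuppAntidiag_univ.1 hk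
    rw [← tsub_add_cancel_of_le hle] at h1
    simpa using h1
  · intro k _
    simp

/-- The coefficient recursion lowers `k` to `k - e_i`; shifting the summation index by `e_i` moves
this onto the Hermite polynomials as a raising. -/
theorem hermiteCombination_add_single {d : ℕ} (ħ : ℝ) (Q : Matrix (Fin d) (Fin d) ℂ)
    (n : Fin d →₀ ℕ) (j : Fin d) (y : Fin d → ℂ) :
    hermiteCombination ħ Q (n + Finsupp.single j 1) y
      = ∑ i, ((absMat Q)⁻¹ * Q.map (starRingEnd ℂ)) i j *
          ∑ k ∈ Finset.univ.finsuppAntidiag n.degree,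
            (multiFactorial n : ℂ) / (multiFactorial k : ℂ) * transitionCoeff Q k n *
              scaledHermite ħ (k + Finsupp.single i 1) y := by
  have hdeg : (n + Finsupp.single j 1).degree = n.degree + 1 := by simp
  -- The factor `n_j + 1` of `(n + e_j)!` is what the coefficient recursion consumes. Terms with `k
  -- i = 0` are written as explicit zeros to fit the reindexing lemma.
  have hterm : ∀ k : Fin d →₀ ℕ, (multiFactorial (n + Finsupp.single j 1) : ℂ) /
      (multiFactorial k : ℂ) * transitionCoeff Q k (n + Finsupp.single j 1) * scaledHermite ħ k y
      = ∑ i, if k i = 0 then 0 else (multiFactorial n : ℂ) * ((k i : ℂ) / multiFactorial k) *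
          ((absMat Q)⁻¹ * Q.map (starRingEnd ℂ)) i j *
          transitionCoeff Q (k - Finsupp.single i 1) n * scaledHermite ħ k y := by
    intro k
    have h := transitionCoeff_add_single Q k n j
    calc _ = (multiFactorial n : ℂ) / (multiFactorial k : ℂ) *
          (transitionCoeff Q k (n + Finsupp.single j 1) * (n j + 1)) * scaledHermite ħ k y := by
          rw [multiFactorial_add_single]
          push_cast
          ring
      _ = _ := by
          rw [h, Finset.mul_sum, Finset.sum_mul]
          refine Finset.sum_congr rfl fun i _ => ?_
          split_ifs with h0
          · simp [h0]
          · ring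
  unfold hermiteCombination
  rw [hdeg, Finset.sum_congr rfl fun k _ => hterm k, Finset.sum_comm]
  refine Finset.sum_congr rfl fun i _ => ?_
  rw [sum_finsuppAntidiag_succ, Finset.mul_sum]
  refine Finset.sum_congr rfl fun k _ => ?_
  have hk : (k i : ℂ) + 1 ≠ 0 := Nat.cast_add_one_ne_zero _
  have hq : (((k + Finsupp.single i 1 : Fin d →₀ ℕ) i : ℕ) : ℂ) /
      (multiFactorial (k + Finsupp.single i 1) : ℂ) = (multiFactorial k : ℂ)⁻¹ := by
    have := multiFactorial_ne_zero k
    rw [multiFactorial_add_single]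
    simp only [Finsupp.coe_add, Pi.add_apply, Finsupp.single_eq_same]
    push_cast
    field_simp
  rw [hq, add_tsub_cancel_right]
  ring

theorem hasFDerivAt_hermiteCombination {d : ℕ} {E : Type*} [NormedAddCommGroup E]
    [NormedSpace ℝ E] (ħ : ℝ) (Q : Matrix (Fin d) (Fin d) ℂ) (n : Fin d →₀ ℕ)
    {y : E → Fin d → ℂ} {y' : Fin d → E →L[ℝ] ℂ} {x : E}
    (hy : ∀ i, HasFDerivAt (fun x => y x i) (y' i) x) :
    HasFDerivAt (fun x => hermiteCombination ħ Q n (y x))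
      (∑ i, ((Real.sqrt ħ : ℂ)⁻¹ * (2 * (y x i / (Real.sqrt ħ : ℂ)) * hermiteCombination ħ Q n (y x)
        - ∑ k ∈ Finset.univ.finsuppAntidiag n.degree,
            (multiFactorial n : ℂ) / (multiFactorial k : ℂ) * transitionCoeff Q k n *
              scaledHermite ħ (k + Finsupp.single i 1) (y x))) • y' i) x := by
  have h := HasFDerivAt.fun_sum (u := Finset.univ.finsuppAntidiag n.degree) fun k _ =>
    (hasFDerivAt_scaledHermite ħ k hy).const_mul
      ((multiFactorial n : ℂ) / (multiFactorial k : ℂ) * transitionCoeff Q k n)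
  refine h.congr_fderiv ?_
  simp only [Finset.smul_sum]
  rw [Finset.sum_comm]
  refine Finset.sum_congr rfl fun i _ => ?_
  simp only [smul_smul]
  rw [← Finset.sum_smul]
  congr 1
  unfold hermiteCombination
  rw [Finset.mul_sum, ← Finset.sum_sub_distrib, Finset.mul_sum]
  exact Finset.sum_congr rfl fun k _ => by ring

/-! ### The raising operators on multiples of the ground state -/

theorem hasFDerivAt_ofReal_sub {d : ℕ} (q : Fin d → ℝ) (l : Fin d) (x : Fin d → ℝ) :
    HasFDerivAt (fun x : Fin d → ℝ => ((x l - q l : ℝ) : ℂ))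
      (Complex.ofRealCLM.comp (ContinuousLinearMap.proj (R := ℝ) (φ := fun _ : Fin d => ℝ) l)) x :=
  Complex.ofRealCLM.hasFDerivAt.comp x ((hasFDerivAt_apply l x).sub_const (q l))

theorem fderiv_groundState {d : ℕ} (ħ : ℝ) {S : Matrix (Fin d ⊕ Fin d) (Fin d ⊕ Fin d) ℝ}
    (hS : S ∈ Matrix.symplecticGroup (Fin d) ℝ) (q p : Fin d → ℝ) (σ : ℂ) (x : Fin d → ℝ)
    (l : Fin d) :
    fderiv ℝ (groundState ħ S q p σ) x (Pi.single l 1)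
      = Complex.I / ħ * (∑ j, (matP S * (matQ S)⁻¹) l j * ((x j - q j : ℝ) : ℂ) + p l)
        * groundState ħ S q p σ x := by
  -- Symmetry makes the two terms of the differentiated quadratic form equal, which cancels the
  -- `1/2`.
  have hsymm : ∀ i j, (matP S * (matQ S)⁻¹) i j = (matP S * (matQ S)⁻¹) j i := fun i j =>
    (congrFun (congrFun (transpose_matP_mul_inv hS) i) j).symm
  have h1 := fun i => hasFDerivAt_ofReal_sub q i x
  have h2 : HasFDerivAt (fun x : Fin d → ℝ => ∑ i, ∑ j, ((x i - q i : ℝ) : ℂ) *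
      (matP S * (matQ S)⁻¹) i j * ((x j - q j : ℝ) : ℂ)) _ x :=
    HasFDerivAt.fun_sum (u := Finset.univ) fun i _ =>
      HasFDerivAt.fun_sum (u := Finset.univ) fun j _ =>
        ((h1 i).mul_const ((matP S * (matQ S)⁻¹) i j)).fun_mul (h1 j)
  have h3 : HasFDerivAt (fun x : Fin d → ℝ => ∑ i, (p i : ℂ) * ((x i - q i : ℝ) : ℂ)) _ x :=
    HasFDerivAt.fun_sum (u := Finset.univ) fun i _ => (h1 i).const_mul (p i : ℂ)
  have h4 := ((((h2.const_mul (1 / 2)).fun_add h3).const_mul (Complex.I / (ħ : ℂ))).cexp).const_mul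
    (σ⁻¹ / (((Real.pi * ħ) ^ ((d : ℝ) / 4) : ℝ) : ℂ))
  rw [HasFDerivAt.fderiv (f := groundState ħ S q p σ) h4]
  simp only [smul_apply, add_apply, sum_apply, ContinuousLinearMap.comp_apply,
    ContinuousLinearMap.proj_apply, Pi.single_apply, Complex.ofRealCLM_apply,
    apply_ite Complex.ofReal, Complex.ofReal_one, Complex.ofReal_zero, smul_eq_mul, mul_ite,
    mul_one, mul_zero, Finset.sum_add_distrib, Finset.sum_ite_eq',
    Finset.mem_univ, if_true]
  have h5 : (∑ i, ∑ j, if i = l then ((x j - q j : ℝ) : ℂ) * (matP S * (matQ S)⁻¹) i j else 0)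
      = ∑ j, (matP S * (matQ S)⁻¹) l j * ((x j - q j : ℝ) : ℂ) := by
    rw [Finset.sum_comm]
    simp [mul_comm]
  have h6 : (∑ i, ((x i - q i : ℝ) : ℂ) * (matP S * (matQ S)⁻¹) i l)
      = ∑ j, (matP S * (matQ S)⁻¹) l j * ((x j - q j : ℝ) : ℂ) :=
    Finset.sum_congr rfl fun i _ => by rw [hsymm i l, mul_comm]
  rw [h5, h6]
  unfold groundState
  ring

/-- The derivative of the Gaussian phase cancels the momentum `p` and combines with `P^*(x-q)` to
`-2i Q⁻¹(x-q)`. The factor `√2` clears that of `√(2ħ)` and is supplied later by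
`normConst_add_single`. -/
theorem raising_groundState_mul {d : ℕ} {ħ : ℝ} (hħ : 0 < ħ)
    {S : Matrix (Fin d ⊕ Fin d) (Fin d ⊕ Fin d) ℝ} (hS : S ∈ Matrix.symplecticGroup (Fin d) ℝ)
    (q p : Fin d → ℝ) (σ : ℂ) (j : Fin d) {g : (Fin d → ℝ) → ℂ} {x : Fin d → ℝ}
    (hg : DifferentiableAt ℝ g x) :
    (Real.sqrt 2 : ℂ) * raising ħ S q p j (fun y => groundState ħ S q p σ y * g y) x
      = groundState ħ S q p σ x *
        (2 / (Real.sqrt ħ : ℂ) * ((matQ S)⁻¹.mulVec fun l => ((x l - q l : ℝ) : ℂ)) j * g x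
          - Real.sqrt ħ * ∑ l, (matQ S).conjTranspose j l * fderiv ℝ g x (Pi.single l 1)) := by
  have hφ : DifferentiableAt ℝ (groundState ħ S q p σ) x :=
    (contDiff_groundState ħ S q p σ).differentiable (by simp) x
  have hd : ∀ l, fderiv ℝ (fun y => groundState ħ S q p σ y * g y) x (Pi.single l 1)
      = groundState ħ S q p σ x * (fderiv ℝ g x (Pi.single l 1) + Complex.I / ħ * g x *
        (((matP S * (matQ S)⁻¹).mulVec fun l => ((x l - q l : ℝ) : ℂ)) l + p l)) := fun l => by
    rw [fderiv_fun_mul hφ hg, add_apply, smul_apply, smul_apply, fderiv_groundState ħ hS]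
    simp only [smul_eq_mul, Matrix.mulVec, dotProduct]
    ring
  have hm := congrFun (congrArg (fun M => M.mulVec fun l => ((x l - q l : ℝ) : ℂ))
    (matP_conjTranspose_sub hS)) j
  simp only [Matrix.sub_mulVec, ← Matrix.mulVec_mulVec, Matrix.smul_mulVec, Pi.sub_apply,
    Pi.smul_apply, smul_eq_mul] at hm
  rw [Matrix.mulVec_mulVec _ (matP S)] at hm
  have hħ0 : (ħ : ℂ) ≠ 0 := by exact_mod_cast hħ.ne'
  have hs0 : (Real.sqrt ħ : ℂ) ≠ 0 := by exact_mod_cast (Real.sqrt_pos.2 hħ).ne'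
  have h20 : (Real.sqrt 2 : ℂ) ≠ 0 := by exact_mod_cast (Real.sqrt_pos.2 two_pos).ne'
  have hss : (Real.sqrt ħ : ℂ) * Real.sqrt ħ = ħ := by exact_mod_cast Real.mul_self_sqrt hħ.le
  rw [raising_eq, Real.sqrt_mul zero_le_two]
  simp only [hd]
  generalize hV : (matP S * (matQ S)⁻¹).mulVec (fun l => ((x l - q l : ℝ) : ℂ)) = V at *
  have e1 : ∑ l, ((matP S).conjTranspose j l * ((x l - q l : ℝ) : ℂ)
      + (matQ S).conjTranspose j l * (p l : ℂ))
      = (matP S).conjTranspose.mulVec (fun l => ((x l - q l : ℝ) : ℂ)) j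
        + ∑ l, (matQ S).conjTranspose j l * (p l : ℂ) := by
    rw [Finset.sum_add_distrib]; rfl
  have e2 : ∑ l, (matQ S).conjTranspose j l * (groundState ħ S q p σ x *
        (fderiv ℝ g x (Pi.single l 1) + Complex.I / ħ * g x * (V l + p l)))
      = groundState ħ S q p σ x * (∑ l, (matQ S).conjTranspose j l * fderiv ℝ g x (Pi.single l 1)
        + Complex.I / ħ * g x * ((matQ S).conjTranspose.mulVec V j
          + ∑ l, (matQ S).conjTranspose j l * (p l : ℂ))) := by
    simp only [Matrix.mulVec, dotProduct]
    rw [← Finset.sum_add_distrib, Finset.mul_sum, ← Finset.sum_add_distrib, Finset.mul_sum]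
    exact Finset.sum_congr rfl fun l _ => by ring
  rw [e1, e2, sub_eq_iff_eq_add.1 hm]
  generalize (matQ S).conjTranspose.mulVec V j = a
  generalize ∑ l, (matQ S).conjTranspose j l * (p l : ℂ) = b
  generalize ∑ l, (matQ S).conjTranspose j l * fderiv ℝ g x (Pi.single l 1) = c
  generalize groundState ħ S q p σ x = φ
  generalize (matQ S)⁻¹.mulVec (fun l => ((x l - q l : ℝ) : ℂ)) j = u
  -- Replacing `ħ` by `√ħ * √ħ` leaves a rational identity in `√2`, `√ħ` and `i`.
  rw [Complex.ofReal_mul, ← hss]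
  field_simp
  ring_nf
  simp only [Complex.I_sq, Complex.I_pow_three]
  ring

theorem normConst_add_single {d : ℕ} (n : Fin d →₀ ℕ) (j : Fin d) :
    normConst (n + Finsupp.single j 1) = Real.sqrt 2 * Real.sqrt (n j + 1) * normConst n := by
  unfold normConst
  rw [← Real.sqrt_mul zero_le_two, ← Real.sqrt_mul (by positivity), multiFactorial_add_single]
  congr 1
  have : (n + Finsupp.single j 1).degree = n.degree + 1 := by simp
  rw [this]
  push_cast
  ring

theorem normConst_pos {d : ℕ} (n : Fin d →₀ ℕ) : 0 < normConst n :=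
  Real.sqrt_pos.2 (mul_pos (by positivity)
    (by exact_mod_cast Nat.pos_of_ne_zero (multiFactorial_ne_zero n)))

theorem groundState_ne_zero {d : ℕ} {ħ : ℝ} (hħ : 0 < ħ)
    (S : Matrix (Fin d ⊕ Fin d) (Fin d ⊕ Fin d) ℝ) (q p : Fin d → ℝ) {σ : ℂ} (hσ : σ ≠ 0)
    (x : Fin d → ℝ) : groundState ħ S q p σ x ≠ 0 := by
  have h : (((Real.pi * ħ) ^ ((d : ℝ) / 4) : ℝ) : ℂ) ≠ 0 := by
    exact_mod_cast (Real.rpow_pos_of_pos (mul_pos Real.pi_pos hħ) _).ne'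
  exact mul_ne_zero (div_ne_zero (inv_ne_zero hσ) h) (Complex.exp_ne_zero _)

/-- The recursion `𝒫_{n+e_j} = (2/√ħ) (Q⁻¹(x-q))_j 𝒫_n - √ħ (Q^* ∇𝒫_n)_j`. -/
theorem hagedornPoly_add_single {d : ℕ} {ħ : ℝ} (hħ : 0 < ħ)
    {S : Matrix (Fin d ⊕ Fin d) (Fin d ⊕ Fin d) ℝ} (hS : S ∈ Matrix.symplecticGroup (Fin d) ℝ)
    (q p : Fin d → ℝ) {σ : ℂ} (hσ : σ ≠ 0) (n : Fin d →₀ ℕ) (j : Fin d) {x : Fin d → ℝ}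
    (hn : DifferentiableAt ℝ (hagedornPoly ħ S q p σ n) x) :
    hagedornPoly ħ S q p σ (n + Finsupp.single j 1) x
      = 2 / (Real.sqrt ħ : ℂ) * ((matQ S)⁻¹.mulVec fun l => ((x l - q l : ℝ) : ℂ)) j
          * hagedornPoly ħ S q p σ n x
        - Real.sqrt ħ * ∑ l, (matQ S).conjTranspose j l *
            fderiv ℝ (hagedornPoly ħ S q p σ n) x (Pi.single l 1) := by
  have hφ := groundState_ne_zero hħ S q p hσ
  have hc : (normConst n : ℂ) ≠ 0 := by exact_mod_cast (normConst_pos n).ne'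
  have hr : (Real.sqrt (n j + 1) : ℂ) ≠ 0 := by
    exact_mod_cast (Real.sqrt_pos.2 (by positivity)).ne'
  have hw : ContDiff ℝ (⊤ : ℕ∞) (wavePacket ħ S q p σ n) :=
    contDiff_const.mul (contDiff_foldr_raising ħ S q p n _ (contDiff_groundState ħ S q p σ))
  -- `c_n φ_n = φ_0 𝒫_n`, so the conjugated raising operator applies with `g = 𝒫_n`, while `c_n`
  -- comes out by linearity.
  have hfac : (fun y => (normConst n : ℂ) * wavePacket ħ S q p σ n y)
      = fun y => groundState ħ S q p σ y * hagedornPoly ħ S q p σ n y := by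
    funext y
    have := hφ y
    unfold hagedornPoly
    field_simp
  have h := raising_groundState_mul hħ hS q p σ j hn
  rw [← hfac, raising_const_mul ħ S q p j _ hw] at h
  rw [hagedornPoly, normConst_add_single, wavePacket_add_single ħ hS, mul_div_assoc',
    div_eq_iff (hφ x), mul_comm _ (groundState ħ S q p σ x), ← h]
  push_cast
  field_simp

theorem hagedornPoly_zero {d : ℕ} {ħ : ℝ} (hħ : 0 < ħ)
    (S : Matrix (Fin d ⊕ Fin d) (Fin d ⊕ Fin d) ℝ) (q p : Fin d → ℝ) {σ : ℂ} (hσ : σ ≠ 0)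
    (x : Fin d → ℝ) : hagedornPoly ħ S q p σ 0 x = 1 := by
  rw [hagedornPoly, wavePacket_zero, div_self (groundState_ne_zero hħ S q p hσ x)]
  simp [normConst, multiFactorial]

/-! ### The expansion in scaled Hermite polynomials -/

/-- The combinations of scaled Hermite polynomials satisfy the recursion of
`hagedornPoly_add_single`. -/
theorem hermiteCombination_add_single_eq_fderiv {d : ℕ} {ħ : ℝ} (hħ : 0 < ħ)
    {S : Matrix (Fin d ⊕ Fin d) (Fin d ⊕ Fin d) ℝ} (hS : S ∈ Matrix.symplecticGroup (Fin d) ℝ)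
    (q : Fin d → ℝ) (n : Fin d →₀ ℕ) (j : Fin d) (x : Fin d → ℝ) :
    let R := fun (n : Fin d →₀ ℕ) (x : Fin d → ℝ) => hermiteCombination ħ (matQ S) n
      ((absMat (matQ S))⁻¹.mulVec fun l => ((x l - q l : ℝ) : ℂ))
    DifferentiableAt ℝ (R n) x ∧ R (n + Finsupp.single j 1) x
      = 2 / (Real.sqrt ħ : ℂ) * ((matQ S)⁻¹.mulVec fun l => ((x l - q l : ℝ) : ℂ)) j * R n x
        - Real.sqrt ħ * ∑ l, (matQ S).conjTranspose j l * fderiv ℝ (R n) x (Pi.single l 1) := by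
  intro R
  have hs0 : (Real.sqrt ħ : ℂ) ≠ 0 := by exact_mod_cast (Real.sqrt_pos.2 hħ).ne'
  set M := (absMat (matQ S))⁻¹ with hM
  set U := M * (matQ S).map (starRingEnd ℂ) with hU
  have hy : ∀ i, HasFDerivAt
      (fun x : Fin d → ℝ => (M.mulVec fun l => ((x l - q l : ℝ) : ℂ)) i)
      (∑ l, M i l • Complex.ofRealCLM.comp
        (ContinuousLinearMap.proj (R := ℝ) (φ := fun _ : Fin d => ℝ) l)) x := fun i =>
    HasFDerivAt.fun_sum (u := Finset.univ) fun l _ =>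
      (hasFDerivAt_ofReal_sub q l x).const_mul (M i l)
  have hR := hasFDerivAt_hermiteCombination ħ (matQ S) n hy
  refine ⟨hR.differentiableAt, ?_⟩
  rw [HasFDerivAt.fderiv (f := R n) hR]
  simp only [R, hermiteCombination_add_single]
  -- Writing `Q⁻¹ = Uᵀ |Q|⁻¹` expresses the linear term through `y`; then `y`, the combination `r`
  -- and its raised versions `F` can be treated as free quantities.
  rw [← hM, ← hU, ← transition_transpose_mul hS, ← hM, ← hU, ← Matrix.mulVec_mulVec]
  generalize M.mulVec (fun l => ((x l - q l : ℝ) : ℂ)) = y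
  generalize hermiteCombination ħ (matQ S) n y = r
  generalize hF : (fun i => ∑ k ∈ Finset.univ.finsuppAntidiag n.degree,
    (multiFactorial n : ℂ) / (multiFactorial k : ℂ) * transitionCoeff (matQ S) k n *
      scaledHermite ħ (k + Finsupp.single i 1) y) = F
  simp only [funext_iff] at hF
  simp only [hF]
  -- This turns `Q^* ∇_x` into `Uᵀ ∇_y`.
  have hMT : ∀ i, ∑ l, (matQ S).conjTranspose j l * M i l = U i j := fun i => by
    rw [hU, Matrix.mul_apply]
    refine Finset.sum_congr rfl fun l _ => ?_
    rw [mul_comm]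
    rfl
  have hD : ∀ l, (∑ i, ((Real.sqrt ħ : ℂ)⁻¹ * (2 * (y i / (Real.sqrt ħ : ℂ)) * r - F i)) •
      ∑ l, M i l • Complex.ofRealCLM.comp
        (ContinuousLinearMap.proj (R := ℝ) (φ := fun _ : Fin d => ℝ) l)) (Pi.single l 1)
      = ∑ i, ((Real.sqrt ħ : ℂ)⁻¹ * (2 * (y i / (Real.sqrt ħ : ℂ)) * r - F i)) * M i l := fun l => by
    simp [Pi.single_apply, apply_ite Complex.ofReal]
  simp only [hD, Finset.mul_sum (Finset.univ : Finset (Fin d))]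
  rw [Finset.sum_comm]
  simp only [Matrix.mulVec, dotProduct, Matrix.transpose_apply, Finset.mul_sum, Finset.sum_mul]
  rw [← Finset.sum_sub_distrib]
  refine Finset.sum_congr rfl fun i _ => ?_
  rw [← hMT i]
  simp only [Finset.sum_mul, Finset.mul_sum]
  rw [← Finset.sum_sub_distrib]
  refine Finset.sum_congr rfl fun l _ => ?_
  field_simp
  ring

/-- Induction on the degree: for `n ≠ 0` any single direction `j` with `n j ≠ 0` suffices. The
differentiability of `𝒫_m` required by its recursion comes from the induction hypothesis. -/
theorem hagedornPoly_eq_hermiteCombination {d : ℕ} {ħ : ℝ} (hħ : 0 < ħ)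
    {S : Matrix (Fin d ⊕ Fin d) (Fin d ⊕ Fin d) ℝ} (hS : S ∈ Matrix.symplecticGroup (Fin d) ℝ)
    (q p : Fin d → ℝ) {σ : ℂ} (hσ : σ ≠ 0) (n : Fin d →₀ ℕ) :
    hagedornPoly ħ S q p σ n = fun x => hermiteCombination ħ (matQ S) n
      ((absMat (matQ S))⁻¹.mulVec fun l => ((x l - q l : ℝ) : ℂ)) := by
  induction hN : n.degree generalizing n with
  | zero =>
    obtain rfl := (Finsupp.degree_eq_zero_iff n).1 hN
    funext x
    rw [hagedornPoly_zero hħ S q p hσ, hermiteCombination_zero]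
  | succ N ih =>
    have hn : n ≠ 0 := fun h => by simp [h] at hN
    obtain ⟨j, hj⟩ := Finsupp.ne_iff.1 hn
    have hle : Finsupp.single j 1 ≤ n := by simpa using Nat.one_le_iff_ne_zero.2 hj
    obtain ⟨m, rfl⟩ : ∃ m, n = m + Finsupp.single j 1 := ⟨_, (tsub_add_cancel_of_le hle).symm⟩
    have hm := ih m (by simpa using hN)
    funext x
    obtain ⟨h1, h2⟩ := hermiteCombination_add_single_eq_fderiv hħ hS q m j x
    rw [hagedornPoly_add_single hħ hS q p hσ m j (by rw [hm]; exact h1), hm]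
    exact h2.symm

end Hagedorn

end

theorem mainTheorem6 (d : ℕ) (ħ : ℝ) (hħ : 0 < ħ)
    (S : Matrix (Fin d ⊕ Fin d) (Fin d ⊕ Fin d) ℝ)
    (hS : S ∈ Matrix.symplecticGroup (Fin d) ℝ)
    (q p : Fin d → ℝ) (σ : ℂ) (hσ : σ ^ 2 = (matQ S).det) :
    (∀ k n : Fin d →₀ ℕ, k.degree ≠ n.degree → transitionCoeff (matQ S) k n = 0) ∧
    (∀ (k : Fin d →₀ ℕ) (w : Fin d → ℂ),
      ∏ i, (((absMat (matQ S))⁻¹ * (matQ S).map (starRingEnd ℂ)).mulVec w) i ^ k i =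
        ∑ n ∈ Finset.univ.finsuppAntidiag k.degree,
          transitionCoeff (matQ S) k n * ∏ j, w j ^ n j) ∧
    (∀ (n : Fin d →₀ ℕ) (x : Fin d → ℝ),
      hagedornPoly ħ S q p σ n x =
        ∑ k ∈ Finset.univ.finsuppAntidiag n.degree,
          (multiFactorial n : ℂ) / (multiFactorial k : ℂ) * transitionCoeff (matQ S) k n *
            scaledHermite ħ k
              ((absMat (matQ S))⁻¹.mulVec fun j => ((x j - q j : ℝ) : ℂ))) := by
  -- Only `σ ≠ 0` matters, since it makes the ground state nowhere zero; hence either square root is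
  -- allowed.
  have hσ0 : σ ≠ 0 := fun h => det_matQ_ne_zero hS (by rw [← hσ, h]; simp)
  exact ⟨fun k n h => transitionCoeff_eq_zero _ h, prod_mulVec_pow_eq_sum_transitionCoeff _,
    fun n x => congrFun (hagedornPoly_eq_hermiteCombination hħ hS q p hσ0 n) x⟩
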